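/- Let $(\Omega,\mathcal F,\mathbb P)$ be a complete probability space with a filtration $(\mathcal F_t)_{t\ge 0}$ satisfying the usual conditions, and let $b\mathcal P$ be the Banach space of all bounded predictable functions $h:[0,\infty)\times\Omega\to\mathbb R$ with the norm $\|h\|_u=\sup_{(t,\omega)}|h(t,\omega)|$. Let $\Phi$ be a real Hausdorff locally convex space which is complete, barrelled and nuclear, i.e. its topology is generated by a family $\Pi$ of Hilbertian seminorms such that for each $p\in\Pi$ there is $q\in\Pi$ with $p\le q$ for which the canonical map $\Phi_q\to\Phi_p$ between the completions of $\Phi/\ker q$ and $\Phi/\ker p$ is Hilbert-Schmidt. Let $\Phi'$ be its strong dual, $\mathcal L_b(\Phi',b\mathcal P)$ the space of continuous linear maps $\Phi'\to b\mathcal P$ with the topology of uniform convergence on bounded subsets of $\Phi'$, and $\Phi\,\widehat\otimes_\pi\, b\mathcal P$ the completion of $\Phi\otimes b\mathcal P$ in the projective topology (generated by the seminorms $(p\otimes q)(\theta)=\inf\sum_j p(\phi_j)q(h_j)$, the infimum over all finite representations $\theta=\sum_j\phi_j\otimes h_j$, with $p,q$ continuous seminorms on $\Phi$ and $b\mathcal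 P$). Let $b\mathcal P(\Phi)$ be the space of all maps $H:[0,\infty)\times\Omega\to\Phi$ such that for every $f\in\Phi'$ the function $\langle f,H\rangle:(t,\omega)\mapsto\langle f,H_t(\omega)\rangle$ is predictable and bounded, equipped with the topology of convergence in $\Phi$ uniformly on $[0,\infty)\times\Omega$. Then there are linear homeomorphisms $$\Phi\,\widehat\otimes_\pi\, b\mathcal P\;\simeq\;\mathcal L_b(\Phi',b\mathcal P)\;\simeq\; b\mathcal P(\Phi),$$ where the first one sends $\phi\otimes h$ to the map $f\mapsto\langle f,\phi\rangle h$, and the second one sends $G$ to the process $H$ determined by $\langle f,H_t(\omega)\rangle=G(f)_t(\omega)$ for all $f\in\Phi'$, $t\ge 0$, $\omega\in\Omega$; that is, its inverse is $H\mapsto[f\mapsto\langle f,H\rangle]$. -/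

import Mathlib

open MeasureTheory UniformSpace TopologicalSpace
open scoped NNReal ENNReal TensorProduct UniformConvergence Topology

noncomputable section

/-! ### Hilbertian seminorms, Hilbert-Schmidt maps and nuclear spaces -/

section Nuclear

variable {E : Type*} [AddCommGroup E] [Module ℝ E]

variable (E) in
/-- A symmetric, non-negative bilinear form on a real vector space. Such forms `Q` correspond
(by polarization) to the Hilbertian seminorms `x ↦ √(Q x x)`. -/
structure HilbertForm where
  form : LinearMap.BilinForm ℝ E
  symm : ∀ x y, form x y = form y x
  nonneg : ∀ x, 0 ≤ form x x

namespace HilbertForm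

/-- The semi-inner product on `E` given by the form. -/
@[reducible] def core (Q : HilbertForm E) : PreInnerProductSpace.Core ℝ E where
  inner x y := Q.form x y
  conj_inner_symm x y := by simpa using Q.symm y x
  re_inner_nonneg x := by simpa using Q.nonneg x
  add_left x y z := by simp
  smul_left x y r := by simp

/-- The space `E`, equipped with the semi-inner product `Q` and the seminorm `√(Q x x)`. -/
def Pre (_Q : HilbertForm E) : Type _ := E

instance (Q : HilbertForm E) : SeminormedAddCommGroup Q.Pre :=
  @InnerProductSpace.Core.toSeminormedAddCommGroup ℝ E _ _ _ Q.core

instance (Q : HilbertForm E) : InnerProductSpace ℝ Q.Pre :=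
  @InnerProductSpace.ofCore ℝ E _ _ _ Q.core

/-- The identity of `E`, as a linear map to `E` with the seminorm of `Q`. -/
def toPre (Q : HilbertForm E) : E →ₗ[ℝ] Q.Pre where
  toFun x := x
  map_add' _ _ := rfl
  map_smul' _ _ := rfl

/-- The Hilbertian seminorm `p` with `p x ^ 2 = Q x x`. -/
def seminorm (Q : HilbertForm E) : Seminorm ℝ E := (normSeminorm ℝ Q.Pre).comp Q.toPre

theorem seminorm_apply (Q : HilbertForm E) (x : E) : Q.seminorm x = √(Q.form x x) := rfl

/-- The Hilbert space attached to the Hilbertian seminorm `p` of `Q`: the (Hausdorff) completion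
of `(E, p)`, which is the completion of the normed space `E / ker p`. -/
abbrev Hilbert (Q : HilbertForm E) : Type _ := Completion Q.Pre

/-- The identity of `E` as a continuous linear map `(E, q) → (E, p)`, for `p ≤ q`. -/
def preLink {P Q : HilbertForm E} (h : P.seminorm ≤ Q.seminorm) : Q.Pre →L[ℝ] P.Pre :=
  LinearMap.mkContinuous
    { toFun := fun x => P.toPre x
      map_add' := fun _ _ => rfl
      map_smul' := fun _ _ => rfl } 1 (fun x => by simpa using! h x)

/-- The canonical map `i_{p,q} : E_q → E_p` between the local Hilbert spaces, for `p ≤ q`: the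
continuous linear extension of the identity of `E`. -/
def link {P Q : HilbertForm E} (h : P.seminorm ≤ Q.seminorm) : Q.Hilbert →L[ℝ] P.Hilbert :=
  (preLink h).completion

end HilbertForm

/-- A continuous linear map `T` between real Hilbert spaces is Hilbert-Schmidt if
`∑ ‖T (b i)‖ ^ 2 < ∞` for an orthonormal (Hilbert) basis `b` of the domain. -/
def IsHilbertSchmidt {H K : Type*} [NormedAddCommGroup H] [InnerProductSpace ℝ H]
    [NormedAddCommGroup K] [InnerProductSpace ℝ K] (T : H →L[ℝ] K) : Prop :=
  ∃ (s : Set H) (b : HilbertBasis s ℝ H), Summable fun i => ‖T (b i)‖ ^ 2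

variable (E) in
/-- A topological vector space is nuclear if its topology is generated by a family of
Hilbertian seminorms such that for each `p` in the family there is `q ≥ p` in the family with
`i_{p,q} : E_q → E_p` Hilbert-Schmidt. (Hausdorffness is assumed separately.) -/
def IsNuclearSpace [TopologicalSpace E] : Prop :=
  ∃ S : Set (HilbertForm E),
    WithSeminorms (fun P : S => P.1.seminorm) ∧
      ∀ P ∈ S, ∃ Q ∈ S, ∃ h : P.seminorm ≤ Q.seminorm, IsHilbertSchmidt (HilbertForm.link h)

end Nuclear

/-! ### The completed projective tensor product -/

section Projective

variable {E F : Type*} [AddCommGroup E] [Module ℝ E] [AddCommGroup F] [Module ℝ F]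

/-- The sums `∑ p (x_j) q (y_j)` over all finite representations `θ = ∑ x_j ⊗ y_j`. -/
def projSums (p : Seminorm ℝ E) (q : Seminorm ℝ F) (θ : E ⊗[ℝ] F) : Set ℝ :=
  {r | ∃ l : List (E × F), (l.map fun z => z.1 ⊗ₜ[ℝ] z.2).sum = θ ∧
    r = (l.map fun z => p z.1 * q z.2).sum}

theorem projSums_nonempty (p : Seminorm ℝ E) (q : Seminorm ℝ F) (θ : E ⊗[ℝ] F) :
    (projSums p q θ).Nonempty := by
  induction θ using TensorProduct.induction_on with
  | zero => exact ⟨_, [], by simp, rfl⟩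
  | tmul x y => exact ⟨_, [(x, y)], by simp, rfl⟩
  | add a b ha hb =>
    obtain ⟨_, l, hl, -⟩ := ha
    obtain ⟨_, m, hm, -⟩ := hb
    exact ⟨_, l ++ m, by simp [hl, hm], rfl⟩

theorem projSums_nonneg (p : Seminorm ℝ E) (q : Seminorm ℝ F) (θ : E ⊗[ℝ] F) {r : ℝ}
    (hr : r ∈ projSums p q θ) : 0 ≤ r := by
  obtain ⟨l, -, rfl⟩ := hr
  refine List.sum_nonneg ?_
  intro a ha
  obtain ⟨z, -, rfl⟩ := List.mem_map.1 ha
  exact mul_nonneg (apply_nonneg p _) (apply_nonneg q _)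

theorem projSums_bddBelow (p : Seminorm ℝ E) (q : Seminorm ℝ F) (θ : E ⊗[ℝ] F) :
    BddBelow (projSums p q θ) :=
  ⟨0, fun _ hr => projSums_nonneg p q θ hr⟩

/-- The seminorm `(p ⊗ q)(θ) = inf ∑ p (x_j) q (y_j)`, the infimum over all finite
representations `θ = ∑ x_j ⊗ y_j`. -/
def projSeminorm (p : Seminorm ℝ E) (q : Seminorm ℝ F) : Seminorm ℝ (E ⊗[ℝ] F) :=
  Seminorm.ofSMulLE (fun θ => sInf (projSums p q θ))
    (le_antisymm (csInf_le (projSums_bddBelow p q 0) ⟨[], by simp, by simp⟩)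
      (Real.sInf_nonneg fun _ hr => projSums_nonneg p q 0 hr))
    (fun a b => by
      refine le_of_forall_pos_le_add fun ε hε => ?_
      obtain ⟨_, ⟨l, hl, rfl⟩, hlt⟩ := Real.lt_sInf_add_pos (projSums_nonempty p q a) (half_pos hε)
      obtain ⟨_, ⟨m, hm, rfl⟩, hmt⟩ := Real.lt_sInf_add_pos (projSums_nonempty p q b) (half_pos hε)
      have := csInf_le (projSums_bddBelow p q (a + b))
        ⟨l ++ m, by simp [hl, hm], rfl⟩
      simp only [List.map_append, List.sum_append] at this
      linarith)
    (fun c a => by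
      rw [← smul_eq_mul, ← Real.sInf_smul_of_nonneg (norm_nonneg c) (projSums p q a)]
      refine le_csInf ((projSums_nonempty p q a).image _) ?_
      rintro _ ⟨_, ⟨l, hl, rfl⟩, rfl⟩
      refine csInf_le (projSums_bddBelow p q (c • a)) ⟨l.map fun z => (c • z.1, z.2), ?_, ?_⟩
      · rw [← hl, List.smul_sum]
        simp [Function.comp_def, TensorProduct.smul_tmul']
      · simp only [smul_eq_mul, ← List.sum_map_mul_left, List.map_map, Function.comp_def,
          map_smul_eq_mul, mul_assoc])

variable (E F) in
/-- The algebraic tensor product `E ⊗ F`, to be equipped with the projective topology. -/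
def ProjTensor : Type _ := E ⊗[ℝ] F

namespace ProjTensor

instance : AddCommGroup (ProjTensor E F) := inferInstanceAs (AddCommGroup (E ⊗[ℝ] F))

instance : Module ℝ (ProjTensor E F) := inferInstanceAs (Module ℝ (E ⊗[ℝ] F))

/-- The elementary tensor `x ⊗ y` in `E ⊗_π F`. -/
def tmul (x : E) (y : F) : ProjTensor E F := x ⊗ₜ[ℝ] y

variable [TopologicalSpace E] [TopologicalSpace F]

variable (E F) in
/-- The family of seminorms `p ⊗ q`, for `p` and `q` continuous seminorms on `E` and `F`. -/
def seminormFamily : SeminormFamily ℝ (ProjTensor E F)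
    ({p : Seminorm ℝ E // Continuous p} × {q : Seminorm ℝ F // Continuous q}) :=
  fun i => projSeminorm i.1.1 i.2.1

/-- The projective topology on `E ⊗ F`: it is generated by the seminorms `p ⊗ q`. -/
instance : TopologicalSpace (ProjTensor E F) := (seminormFamily E F).moduleFilterBasis.topology

theorem withSeminorms : WithSeminorms (seminormFamily E F) := ⟨rfl⟩

instance : IsTopologicalAddGroup (ProjTensor E F) := withSeminorms.topologicalAddGroup

instance : ContinuousSMul ℝ (ProjTensor E F) := withSeminorms.continuousSMul

instance : UniformSpace (ProjTensor E F) := IsTopologicalAddGroup.rightUniformSpace _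

instance : IsUniformAddGroup (ProjTensor E F) := isUniformAddGroup_of_addCommGroup

instance : UniformContinuousConstSMul ℝ (ProjTensor E F) :=
  uniformContinuousConstSMul_of_continuousConstSMul ℝ _

end ProjTensor

variable (E F) in
/-- The completed projective tensor product `E ⊗̂_π F`. -/
abbrev CompletedProjTensor [TopologicalSpace E] [TopologicalSpace F] : Type _ :=
  Completion (ProjTensor E F)

end Projective

/-! ### Bounded predictable processes -/

section Predictable

variable {Ω : Type*} {m : MeasurableSpace Ω}

/-- The usual conditions: the probability space is complete, the filtration is right continuous
and its initial σ-algebra contains all null sets. -/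
structure UsualConditions (P : Measure Ω) (𝓕 : Filtration ℝ≥0 m) : Prop where
  complete : P.IsComplete
  rightContinuous : 𝓕.IsRightContinuous
  nullSets : ∀ N : Set Ω, P N = 0 → MeasurableSet[𝓕 0] N

/-- The space `bP` of bounded predictable processes `[0,∞) × Ω → ℝ`, as a subspace of the Banach
space `ℓ^∞([0,∞) × Ω)` of all bounded functions, with the uniform norm. -/
def boundedPredictable (𝓕 : Filtration ℝ≥0 m) :
    Submodule ℝ (lp (fun _ : ℝ≥0 × Ω => ℝ) ∞) where
  carrier := {h | Measurable[𝓕.predictable] fun z => h z}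
  zero_mem' := @measurable_const _ _ _ 𝓕.predictable 0
  add_mem' := fun ha hb => Measurable.add (m := 𝓕.predictable) ha hb
  smul_mem' := fun c _ ha => Measurable.const_mul (m := 𝓕.predictable) ha c

/-- The space `bP(Φ)` of weakly predictable, weakly bounded `Φ`-valued processes `H`: for each
`f ∈ Φ'` the function `(t, ω) ↦ f (H t ω)` is predictable and bounded. As a subspace of
`[0,∞) × Ω →ᵤ Φ` it carries the topology of uniform convergence on `[0,∞) × Ω`. -/
def weaklyBoundedPredictable (𝓕 : Filtration ℝ≥0 m) (Φ : Type*) [AddCommGroup Φ] [Module ℝ Φ]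
    [UniformSpace Φ] [IsUniformAddGroup Φ] [ContinuousSMul ℝ Φ] :
    Submodule ℝ ((ℝ≥0 × Ω) →ᵤ Φ) where
  carrier := {H | ∀ f : StrongDual ℝ Φ,
    (Measurable[𝓕.predictable] fun z => f (UniformFun.toFun H z)) ∧
      ∃ C : ℝ, ∀ z, |f (UniformFun.toFun H z)| ≤ C}
  zero_mem' := fun f => by
    refine ⟨?_, 0, fun z => ?_⟩
    · simp only [UniformFun.toFun_zero, Pi.zero_apply, map_zero]
      exact @measurable_const _ _ _ 𝓕.predictable 0
    · simp
  add_mem' := fun {a b} ha hb f => by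
    obtain ⟨ha₁, A, hA⟩ := ha f
    obtain ⟨hb₁, B, hB⟩ := hb f
    refine ⟨?_, A + B, fun z => ?_⟩
    · simp only [UniformFun.toFun_add, Pi.add_apply, map_add]
      exact Measurable.add (m := 𝓕.predictable) ha₁ hb₁
    · simp only [UniformFun.toFun_add, Pi.add_apply, map_add]
      exact (abs_add_le _ _).trans (add_le_add (hA z) (hB z))
  smul_mem' := fun c a ha f => by
    obtain ⟨ha₁, A, hA⟩ := ha f
    refine ⟨?_, |c| * A, fun z => ?_⟩
    · simp only [UniformFun.toFun_smul, Pi.smul_apply, map_smul]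
      exact Measurable.const_mul (m := 𝓕.predictable) ha₁ c
    · simp only [UniformFun.toFun_smul, Pi.smul_apply, map_smul, smul_eq_mul, abs_mul]
      exact mul_le_mul_of_nonneg_left (hA z) (abs_nonneg c)

end Predictable

end

/-! Write F for bP. Both isomorphisms come from maps into L_b(Φ', F): `tensorOp` takes φ ⊗ h to f ↦
f(φ)h, and `IsWeakModel.op` takes H to f ↦ ⟨f, H⟩. Each induces its topology from L_b(Φ', F) and has
dense range. Since bP(Φ) is closed in the complete space of all functions into Φ with the uniform
topology, the range of `op` is complete, hence closed, so `op` is onto. This carries completeness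
over to L_b(Φ', F), which is therefore a completion of Φ ⊗_π F. Surjectivity thus needs no appeal to
reflexivity of Φ.

Barrelledness makes strongly bounded subsets of Φ' equicontinuous, which gives continuity of both
maps. For the inverse of `op` it suffices that a Hilbertian seminorm is attained on its polar. For
the inverse of `tensorOp` nuclearity is essential (`exists_projSeminorm_le`): take P ≤ Q ≤ R with
Hilbert-Schmidt links and expand θ along a finite Q-orthonormal set as ∑ e ⊗ T(Q(e, ·)), where T is
the operator of θ. Both P(e) and ‖T(Q(e, ·))‖ are square-summable with bounds independent of the
set, the latter in terms of sup ‖T f‖ over the polar of R.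

Density (`denseRange_tensorOp`) uses that a Hilbert-Schmidt link is a limit of finite rank maps
(`HSDom.exists_approx`). The Hilbert-Schmidt property is recast in `HSDom` through finite families
of vectors of Φ itself, so that these estimates never leave Φ for a completion. -/

noncomputable section

/-! ### Finite orthonormal and Bessel families for a Hilbert form -/

namespace HilbertForm

section Algebra

variable {E : Type*} [AddCommGroup E] [Module ℝ E]

theorem seminorm_sq (Q : HilbertForm E) (x : E) : Q.seminorm x ^ 2 = Q.form x x := by
  rw [seminorm_apply, Real.sq_sqrt (Q.nonneg x)]

theorem abs_form_le (Q : HilbertForm E) (x y : E) :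
    |Q.form x y| ≤ Q.seminorm x * Q.seminorm y :=
  abs_real_inner_le_norm (Q.toPre x) (Q.toPre y)

theorem form_le_of_seminorm_le {P Q : HilbertForm E} (h : P.seminorm ≤ Q.seminorm) (x : E) :
    P.form x x ≤ Q.form x x := by
  rw [← seminorm_sq, ← seminorm_sq]
  exact pow_le_pow_left₀ (apply_nonneg _ _) (h x) 2

theorem seminorm_le_of_form_le {P Q : HilbertForm E} (h : ∀ x, P.form x x ≤ Q.form x x) :
    P.seminorm ≤ Q.seminorm := fun x => by
  rw [seminorm_apply, seminorm_apply]
  exact Real.sqrt_le_sqrt (h x)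

/-- The sum of two Hilbert forms. -/
def add (P Q : HilbertForm E) : HilbertForm E where
  form := P.form + Q.form
  symm x y := by simp [P.symm x y, Q.symm x y]
  nonneg x := by simpa using add_nonneg (P.nonneg x) (Q.nonneg x)

variable (E) in
/-- The zero form. -/
def zero : HilbertForm E where
  form := 0
  symm _ _ := rfl
  nonneg _ := le_rfl

theorem add_form (P Q : HilbertForm E) (x y : E) :
    (P.add Q).form x y = P.form x y + Q.form x y := rfl

theorem le_add_left (P Q : HilbertForm E) : P.seminorm ≤ (P.add Q).seminorm :=
  seminorm_le_of_form_le fun x => by rw [add_form]; linarith [Q.nonneg x]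

theorem le_add_right (P Q : HilbertForm E) : Q.seminorm ≤ (P.add Q).seminorm :=
  seminorm_le_of_form_le fun x => by rw [add_form]; linarith [P.nonneg x]

/-- This is √(a² + b²) ≤ a + b; it keeps sums of continuous Hilbertian seminorms continuous. -/
theorem add_le (P Q : HilbertForm E) : (P.add Q).seminorm ≤ P.seminorm + Q.seminorm := fun x => by
  refine abs_le_of_sq_le_sq' ?_ (add_nonneg (apply_nonneg _ _) (apply_nonneg _ _)) |>.2
  rw [seminorm_sq, add_form, _root_.add_apply, ← seminorm_sq, ← seminorm_sq]
  nlinarith [mul_nonneg (apply_nonneg P.seminorm x) (apply_nonneg Q.seminorm x)]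

/-- A finite set `s` is a Bessel family if `a ↦ ∑ a e • e` is a contraction from `ℓ²(s)`. -/
def IsBessel (Q : HilbertForm E) (s : Finset E) : Prop :=
  ∀ a : E → ℝ, Q.form (∑ e ∈ s, a e • e) (∑ e ∈ s, a e • e) ≤ ∑ e ∈ s, a e ^ 2

/-- A finite set `s` is orthonormal with respect to the form. -/
structure IsOrtho (Q : HilbertForm E) (s : Finset E) : Prop where
  unit : ∀ x ∈ s, Q.form x x = 1
  orth : ∀ x ∈ s, ∀ y ∈ s, x ≠ y → Q.form x y = 0

/-- The residual of `x` after orthogonal projection to the span of `s`. -/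
def resid (Q : HilbertForm E) (s : Finset E) (x : E) : E := x - ∑ e ∈ s, Q.form e x • e

theorem IsBessel.mono {P Q : HilbertForm E} (h : ∀ x, P.form x x ≤ Q.form x x) {s : Finset E}
    (hs : Q.IsBessel s) : P.IsBessel s := fun a => (h _).trans (hs a)

theorem IsOrtho.form_sum {Q : HilbertForm E} {s : Finset E} (hs : Q.IsOrtho s) (a : E → ℝ)
    {y : E} (hy : y ∈ s) : Q.form y (∑ e ∈ s, a e • e) = a y := by
  rw [map_sum, Finset.sum_eq_single_of_mem y hy]
  · simp [hs.unit y hy]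
  · intro b hb hby
    simp [hs.orth y hy b hb hby.symm]

theorem IsOrtho.form_sum_sum {Q : HilbertForm E} {s : Finset E} (hs : Q.IsOrtho s) (a : E → ℝ) :
    Q.form (∑ e ∈ s, a e • e) (∑ e ∈ s, a e • e) = ∑ e ∈ s, a e ^ 2 := by
  rw [map_sum]
  refine Finset.sum_congr rfl fun e he => ?_
  rw [map_smul, Q.symm, hs.form_sum a he, smul_eq_mul, sq]

theorem IsOrtho.isBessel {Q : HilbertForm E} {s : Finset E} (hs : Q.IsOrtho s) : Q.IsBessel s :=
  fun a => (hs.form_sum_sum a).le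

theorem IsOrtho.form_resid {Q : HilbertForm E} {s : Finset E} (hs : Q.IsOrtho s) {y : E}
    (hy : y ∈ s) (x : E) : Q.form y (Q.resid s x) = 0 := by
  rw [resid, map_sub, hs.form_sum (fun e => Q.form e x) hy, sub_self]

theorem IsOrtho.form_sum_resid {Q : HilbertForm E} {s : Finset E} (hs : Q.IsOrtho s) (a : E → ℝ)
    (x : E) : Q.form (∑ e ∈ s, a e • e) (Q.resid s x) = 0 := by
  rw [map_sum, LinearMap.sum_apply]
  refine Finset.sum_eq_zero fun e he => ?_
  rw [map_smul, LinearMap.smul_apply, hs.form_resid he, smul_zero]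

theorem IsOrtho.pythagoras {Q : HilbertForm E} {s : Finset E} (hs : Q.IsOrtho s) (x : E) :
    Q.form x x = ∑ e ∈ s, Q.form e x ^ 2 + Q.form (Q.resid s x) (Q.resid s x) := by
  have hx : x = ∑ e ∈ s, Q.form e x • e + Q.resid s x := by simp [resid]
  have h0 := hs.form_sum_resid (fun e => Q.form e x) x
  have h1 := hs.form_sum_sum (fun e => Q.form e x)
  have h2 := Q.symm (Q.resid s x) (∑ e ∈ s, Q.form e x • e)
  set r := Q.resid s x
  set p := ∑ e ∈ s, Q.form e x • e
  calc Q.form x x = Q.form (p + r) (p + r) := by rw [← hx]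
    _ = _ := by
      rw [LinearMap.BilinForm.add_left, map_add, map_add, h0, h1, h2, h0]
      simp

/-- Normalise r. The enlarged set t is described by membership, so no decidable equality enters the
statement. -/
theorem IsOrtho.exists_insert {Q : HilbertForm E} {s : Finset E} (hs : Q.IsOrtho s) {r : E}
    (hr : ∀ y ∈ s, Q.form y r = 0) (h : Q.form r r ≠ 0) :
    ∃ c : ℝ, c ^ 2 * Q.form r r = 1 ∧ c • r ∉ s ∧
      ∀ t : Finset E, (∀ x, x ∈ t ↔ x = c • r ∨ x ∈ s) → Q.IsOrtho t := by
  have hpos : 0 < Q.form r r := lt_of_le_of_ne (Q.nonneg r) h.symm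
  have hc : (√(Q.form r r))⁻¹ ^ 2 * Q.form r r = 1 := by
    rw [inv_pow, Real.sq_sqrt hpos.le, inv_mul_cancel₀ h]
  set c := (√(Q.form r r))⁻¹
  have hu : Q.form (c • r) (c • r) = 1 := by
    rw [← hc]; simp; ring
  have ho : ∀ y ∈ s, Q.form y (c • r) = 0 := fun y hy => by simp [hr y hy]
  refine ⟨c, hc, fun hmem => ?_, fun t ht => ⟨fun x hx => ?_, fun x hx y hy hxy => ?_⟩⟩
  · have := ho _ hmem
    rw [hu] at this
    exact one_ne_zero this
  · rcases (ht x).1 hx with rfl | hx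
    exacts [hu, hs.unit x hx]
  · rcases (ht x).1 hx with rfl | hx <;> rcases (ht y).1 hy with rfl | hy
    · exact absurd rfl hxy
    · rw [Q.symm, ho y hy]
    · exact ho x hx
    · exact hs.orth x hx y hy hxy

/-- Gram-Schmidt: a finite set is contained in the span of an orthonormal set, up to the kernel of
the form. -/
theorem exists_isOrtho_resid_eq_zero (Q : HilbertForm E) (t : Finset E) :
    ∃ s : Finset E, Q.IsOrtho s ∧ ∀ x ∈ t, Q.form (Q.resid s x) (Q.resid s x) = 0 := by
  classical
  induction t using Finset.induction_on with
  | empty => exact ⟨∅, ⟨by simp, by simp⟩, by simp⟩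
  | insert x t _ ih =>
    obtain ⟨s, hs, hst⟩ := ih
    by_cases hx : Q.form (Q.resid s x) (Q.resid s x) = 0
    · refine ⟨s, hs, fun y hy => ?_⟩
      rcases Finset.mem_insert.1 hy with rfl | hy
      exacts [hx, hst y hy]
    · obtain ⟨c, hc, hcs, hins⟩ := hs.exists_insert (fun y hy => hs.form_resid hy x) hx
      set r := Q.resid s x with hrdef
      have hs' := hins (insert (c • r) s) fun y => Finset.mem_insert
      -- Subtracting the Pythagorean identities for the two sets: a new unit vector lowers the
      -- squared residual by the square of its coefficient.
      have key : ∀ y, Q.form (Q.resid (insert (c • r) s) y) (Q.resid (insert (c • r) s) y) =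
          Q.form (Q.resid s y) (Q.resid s y) - Q.form (c • r) y ^ 2 := fun y => by
        have h1 := hs.pythagoras y
        have h2 := hs'.pythagoras y
        rw [Finset.sum_insert hcs] at h2
        linarith
      refine ⟨_, hs', fun y hy => ?_⟩
      rcases Finset.mem_insert.1 hy with rfl | hy
      · rw [key, ← hrdef]
        have h1 : Q.form r y = Q.form r r := by
          have hy' : y = ∑ e ∈ s, Q.form e y • e + r := by simp [hrdef, resid]
          conv_lhs => rw [hy']
          rw [map_add, Q.symm r (∑ e ∈ s, _), hs.form_sum_resid, zero_add]
        rw [map_smul, LinearMap.smul_apply, h1, smul_eq_mul, mul_pow, sq (Q.form r r), ← mul_assoc,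
          hc, one_mul, sub_self]
      · refine le_antisymm ?_ (Q.nonneg _)
        rw [key, hst y hy, zero_sub]
        exact neg_nonpos.2 (sq_nonneg _)

theorem seminorm_eq_zero_of_form_eq_zero {P Q : HilbertForm E} (h : P.seminorm ≤ Q.seminorm) {x : E}
    (hx : Q.form x x = 0) : P.seminorm x = 0 := by
  refine le_antisymm ((h x).trans ?_) (apply_nonneg _ _)
  rw [seminorm_apply, hx, Real.sqrt_zero]

/-- `P` is dominated by `Q` in the Hilbert-Schmidt sense: `P ≤ Q` and the functionals `P (e, ·)`,
for `e` in a Bessel family of `P`, have square-summable `Q`-norms, with a uniform bound. -/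
structure HSDom (P Q : HilbertForm E) : Prop where
  le : P.seminorm ≤ Q.seminorm
  bound : ∃ C : ℝ, ∀ s : Finset E, P.IsBessel s → ∃ l : E → ℝ, (∀ e, 0 ≤ l e) ∧
    ∑ e ∈ s, l e ^ 2 ≤ C ∧ ∀ e ∈ s, ∀ x, |P.form e x| ≤ l e * Q.seminorm x

theorem HSDom.zero : HSDom (zero E) (zero E) where
  le := le_rfl
  bound := ⟨0, fun s _ => ⟨0, by simp, by simp, fun e _ x => by simp [HilbertForm.zero]⟩⟩

/-- This is why `HSDom` speaks of Bessel families: an orthonormal set for P₁ + P₂ need not be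
orthonormal for P₁ or P₂, but Bessel families pass to smaller forms. The constant comes from (a +
b)² ≤ 2a² + 2b². -/
theorem HSDom.add {P₁ Q₁ P₂ Q₂ : HilbertForm E} (h₁ : HSDom P₁ Q₁) (h₂ : HSDom P₂ Q₂) :
    HSDom (P₁.add P₂) (Q₁.add Q₂) where
  le := seminorm_le_of_form_le fun x =>
    add_le_add (form_le_of_seminorm_le h₁.le x) (form_le_of_seminorm_le h₂.le x)
  bound := by
    obtain ⟨C₁, hC₁⟩ := h₁.bound
    obtain ⟨C₂, hC₂⟩ := h₂.bound
    refine ⟨2 * C₁ + 2 * C₂, fun s hs => ?_⟩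
    obtain ⟨l₁, hl₁, hs₁, hb₁⟩ := hC₁ s (hs.mono (form_le_of_seminorm_le (le_add_left P₁ P₂)))
    obtain ⟨l₂, hl₂, hs₂, hb₂⟩ := hC₂ s (hs.mono (form_le_of_seminorm_le (le_add_right P₁ P₂)))
    refine ⟨l₁ + l₂, fun e => add_nonneg (hl₁ e) (hl₂ e), ?_, fun e he x => ?_⟩
    · calc ∑ e ∈ s, (l₁ + l₂) e ^ 2 ≤ ∑ e ∈ s, (2 * l₁ e ^ 2 + 2 * l₂ e ^ 2) :=
            Finset.sum_le_sum fun e _ => by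
              simp only [Pi.add_apply]; nlinarith [sq_nonneg (l₁ e - l₂ e)]
        _ ≤ _ := by rw [Finset.sum_add_distrib, ← Finset.mul_sum, ← Finset.mul_sum]; linarith
    · rw [add_form, Pi.add_apply, add_mul]
      exact (abs_add_le _ _).trans (add_le_add
        ((hb₁ e he x).trans (mul_le_mul_of_nonneg_left (le_add_left Q₁ Q₂ x) (hl₁ e)))
        ((hb₂ e he x).trans (mul_le_mul_of_nonneg_left (le_add_right Q₁ Q₂ x) (hl₂ e))))

/-- A functional bounded by `c * Q.seminorm` has `ℓ²`-norm at most `c` on Bessel families. -/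
theorem IsBessel.sum_sq_le {Q : HilbertForm E} {s : Finset E} (hs : Q.IsBessel s) (L : E →ₗ[ℝ] ℝ)
    {c : ℝ} (hL : ∀ x, |L x| ≤ c * Q.seminorm x) : ∑ e ∈ s, L e ^ 2 ≤ c ^ 2 := by
  set t := ∑ e ∈ s, L e ^ 2 with ht
  have ht0 : 0 ≤ t := Finset.sum_nonneg fun _ _ => sq_nonneg _
  -- Test L on the vector with coefficients L e: then t ≤ c√t, so t ≤ c².
  have h1 : L (∑ e ∈ s, L e • e) = t := by simp [ht, sq]
  have h2 : Q.seminorm (∑ e ∈ s, L e • e) ^ 2 ≤ t := by rw [seminorm_sq]; exact hs L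
  have h3 := hL (∑ e ∈ s, L e • e)
  rw [h1, abs_of_nonneg ht0] at h3
  have h4 : t ^ 2 ≤ c ^ 2 * t := calc
    t ^ 2 ≤ (c * Q.seminorm (∑ e ∈ s, L e • e)) ^ 2 := pow_le_pow_left₀ ht0 h3 2
    _ ≤ c ^ 2 * t := by rw [mul_pow]; exact mul_le_mul_of_nonneg_left h2 (sq_nonneg c)
  rcases ht0.eq_or_lt with h | h
  · rw [← h]; positivity
  · nlinarith

/-- The Hilbert-Schmidt bound for Bessel families of the larger form. -/
theorem HSDom.exists_sum_le {P Q : HilbertForm E} (h : HSDom P Q) :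
    ∃ C : ℝ, ∀ s : Finset E, Q.IsBessel s → ∑ e ∈ s, P.form e e ≤ C := by
  obtain ⟨C, hC⟩ := h.bound
  refine ⟨C, fun s hs => ?_⟩
  -- Parseval along a P-orthonormal set d spanning s modulo the kernel of P turns the sum into a
  -- double sum. After exchanging the order, each functional P(k, ·) is estimated on the Q-Bessel
  -- family s.
  obtain ⟨d, hd, hds⟩ := P.exists_isOrtho_resid_eq_zero s
  obtain ⟨l, -, hlC, hle⟩ := hC d hd.isBessel
  calc ∑ e ∈ s, P.form e e = ∑ e ∈ s, ∑ k ∈ d, P.form k e ^ 2 :=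
        Finset.sum_congr rfl fun e he => by rw [hd.pythagoras e, hds e he, add_zero]
    _ = ∑ k ∈ d, ∑ e ∈ s, P.form k e ^ 2 := Finset.sum_comm
    _ ≤ ∑ k ∈ d, l k ^ 2 :=
        Finset.sum_le_sum fun k hk => hs.sum_sq_le (P.form k) (hle k hk)
    _ ≤ C := hlC

/-- Approximation of the identity by finite rank operators, uniformly on `Q`-bounded sets. -/
theorem HSDom.exists_approx {P Q : HilbertForm E} (h : HSDom P Q) (M : ℝ) {ε : ℝ} (hε : 0 < ε) :
    ∃ s : Finset E, ∀ x, Q.seminorm x ≤ M → P.seminorm (Q.resid s x) ≤ ε := by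
  classical
  obtain ⟨C, hC⟩ := h.exists_sum_le
  set A : Set ℝ := {r | ∃ s, Q.IsOrtho s ∧ r = ∑ e ∈ s, P.form e e}
  have hA : A.Nonempty := ⟨_, ∅, ⟨by simp, by simp⟩, rfl⟩
  have hAb : BddAbove A := ⟨C, by rintro _ ⟨s, hs, rfl⟩; exact hC s hs.isBessel⟩
  -- Choose s nearly maximising ∑ P(e, e) among Q-orthonormal sets. Adjoining the normalised
  -- residual of x can gain at most ε²/(M² + 1), which bounds P on that residual. The +1 keeps the
  -- denominator positive when M = 0.
  obtain ⟨_, ⟨s, hs, rfl⟩, hlt⟩ := Real.add_neg_lt_sSup hA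
    (ε := -(ε ^ 2 / (M ^ 2 + 1))) (neg_neg_of_pos (by positivity))
  refine ⟨s, fun x hx => ?_⟩
  by_cases hr : Q.form (Q.resid s x) (Q.resid s x) = 0
  · rw [seminorm_eq_zero_of_form_eq_zero h.le hr]; exact hε.le
  obtain ⟨c, hc, hcs, hins⟩ := hs.exists_insert (fun y hy => hs.form_resid hy x) hr
  have hpy := hs.pythagoras x
  have hsum : 0 ≤ ∑ e ∈ s, Q.form e x ^ 2 := Finset.sum_nonneg fun _ _ => sq_nonneg _
  set r := Q.resid s x
  have hmem := le_csSup hAb ⟨insert (c • r) s, hins _ fun y => Finset.mem_insert, rfl⟩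
  rw [Finset.sum_insert hcs] at hmem
  have h1 : c ^ 2 * P.form r r ≤ ε ^ 2 / (M ^ 2 + 1) := by
    have : P.form (c • r) (c • r) = c ^ 2 * P.form r r := by simp; ring
    linarith
  have h2 : Q.form r r ≤ M ^ 2 := by
    have := pow_le_pow_left₀ (apply_nonneg Q.seminorm x) hx 2
    rw [seminorm_sq] at this
    linarith
  refine abs_le_of_sq_le_sq' ?_ hε.le |>.2
  rw [seminorm_sq]
  calc P.form r r = (c ^ 2 * P.form r r) * Q.form r r := by linear_combination -P.form r r * hc
    _ ≤ ε ^ 2 / (M ^ 2 + 1) * (M ^ 2 + 1) :=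
        mul_le_mul h1 (by linarith) (Q.nonneg r) (by positivity)
    _ = ε ^ 2 := by field_simp

end Algebra

end HilbertForm

/-! ### Hilbert-Schmidt links and nuclear spaces -/

namespace HilbertForm

section Links

variable {E : Type*} [AddCommGroup E] [Module ℝ E]

/-- The canonical map of `E` to the Hilbert space of `Q`. -/
def toHilbert (Q : HilbertForm E) : E →ₗ[ℝ] Q.Hilbert :=
  (Completion.toComplL : Q.Pre →L[ℝ] Q.Hilbert).toLinearMap ∘ₗ Q.toPre

theorem norm_toHilbert (Q : HilbertForm E) (x : E) : ‖Q.toHilbert x‖ = Q.seminorm x :=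
  Completion.norm_coe (Q.toPre x)

theorem inner_toHilbert (Q : HilbertForm E) (x y : E) :
    inner ℝ (Q.toHilbert x) (Q.toHilbert y) = Q.form x y :=
  Completion.inner_coe (𝕜 := ℝ) (Q.toPre x) (Q.toPre y)

theorem link_toHilbert {P Q : HilbertForm E} (h : P.seminorm ≤ Q.seminorm) (x : E) :
    link h (Q.toHilbert x) = P.toHilbert x :=
  Completion.map_coe (preLink h).uniformContinuous (Q.toPre x)

/-- With T the link, P(e, x) = ⟨T* e, x⟩, so l e = ‖T* e‖ works. Summing ‖T* e‖² over s and
expanding in the Hilbert basis b, the Bessel property bounds the i-th term by ‖T (b i)‖². -/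
theorem HSDom.of_isHilbertSchmidt {P Q : HilbertForm E} (h : P.seminorm ≤ Q.seminorm)
    (hT : IsHilbertSchmidt (link h)) : HSDom P Q where
  le := h
  bound := by
    obtain ⟨_, b, hb⟩ := hT
    set T := link h with hTdef
    refine ⟨∑' i, ‖T (b i)‖ ^ 2, fun s hs => ⟨fun e => ‖T.adjoint (P.toHilbert e)‖,
      fun e => norm_nonneg _, ?_, fun e _ x => ?_⟩⟩
    · have h1 : ∀ e : E, HasSum (fun i => inner ℝ (T (b i)) (P.toHilbert e) ^ 2)
          (‖T.adjoint (P.toHilbert e)‖ ^ 2) := fun e => by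
        have := b.hasSum_inner_mul_inner (T.adjoint (P.toHilbert e)) (T.adjoint (P.toHilbert e))
        rw [real_inner_self_eq_norm_sq] at this
        refine this.congr_fun fun i => ?_
        rw [real_inner_comm (b i) (T.adjoint _), ContinuousLinearMap.adjoint_inner_right, sq]
      refine hasSum_le (fun i => ?_) (hasSum_sum fun e _ => h1 e) hb.hasSum
      refine hs.sum_sq_le ((innerSL ℝ (T (b i))).toLinearMap ∘ₗ P.toHilbert) fun x => ?_
      rw [← norm_toHilbert]
      exact abs_real_inner_le_norm (T (b i)) (P.toHilbert x)
    · rw [← inner_toHilbert, ← link_toHilbert h x, ← ContinuousLinearMap.adjoint_inner_left,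
        ← norm_toHilbert]
      exact abs_real_inner_le_norm _ _

/-- In a nuclear space every continuous seminorm is dominated by the first of three Hilbertian
continuous seminorms with Hilbert-Schmidt links. -/
theorem exists_of_continuous [TopologicalSpace E] [IsTopologicalAddGroup E]
    (hE : IsNuclearSpace E) (p : Seminorm ℝ E) (hp : Continuous p) :
    ∃ (P Q R : HilbertForm E) (C : ℝ), 0 ≤ C ∧ (∀ x, p x ≤ C * P.seminorm x) ∧
      HSDom P Q ∧ HSDom Q R ∧ Continuous R.seminorm := by
  classical
  obtain ⟨S, hS, hlink⟩ := hE
  obtain ⟨s, C, -, hC⟩ := Seminorm.bound_of_continuous hS p hp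
  -- The generating family is not assumed directed, so a finite supremum is dominated by a sum of
  -- forms, with the links added along.
  suffices H : ∀ s : Finset S, ∃ P Q R : HilbertForm E, (∀ i ∈ s, i.1.seminorm ≤ P.seminorm) ∧
      HSDom P Q ∧ HSDom Q R ∧ Continuous R.seminorm by
    obtain ⟨P, Q, R, hP, h₁, h₂, h₃⟩ := H s
    refine ⟨P, Q, R, C, C.2, fun x => (hC x).trans ?_, h₁, h₂, h₃⟩
    exact mul_le_mul_of_nonneg_left (Finset.sup_le (f := fun i : S => i.1.seminorm) hP x) C.2
  intro s
  induction s using Finset.induction_on with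
  | empty =>
    refine ⟨zero E, zero E, zero E, by simp, HSDom.zero, HSDom.zero, ?_⟩
    have : ((zero E).seminorm : E → ℝ) = fun _ => 0 := by
      ext x; simp [seminorm_apply, zero]
    rw [this]
    exact continuous_const
  | insert i s _ ih =>
    obtain ⟨P, Q, R, hP, h₁, h₂, h₃⟩ := ih
    obtain ⟨Q', hQ', hq, hq'⟩ := hlink i.1 i.2
    obtain ⟨R', hR', hr, hr'⟩ := hlink Q' hQ'
    refine ⟨P.add i.1, Q.add Q', R.add R', fun j hj => ?_,
      h₁.add (.of_isHilbertSchmidt hq hq'), h₂.add (.of_isHilbertSchmidt hr hr'), ?_⟩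
    · rcases Finset.mem_insert.1 hj with rfl | hj
      exacts [le_add_right _ _, (hP j hj).trans (le_add_left _ _)]
    · have hc : Continuous (R.seminorm + R'.seminorm) := by
        rw [FunLike.coe_add]
        exact h₃.add (hS.continuous_seminorm ⟨R', hR'⟩)
      exact Seminorm.continuous_of_le hc (add_le _ _)

end Links

/-! ### Continuous functionals attached to a Hilbert form -/

section Functionals

variable {E : Type*} [AddCommGroup E] [Module ℝ E] [TopologicalSpace E]

theorem _root_.LinearMap.continuous_of_abs_le_seminorm [IsTopologicalAddGroup E] (L : E →ₗ[ℝ] ℝ)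
    {p : Seminorm ℝ E} (hp : Continuous p) {c : ℝ} (hL : ∀ x, |L x| ≤ c * p x) :
    Continuous L := by
  refine continuous_of_continuousAt_zero L ?_
  have h : Filter.Tendsto (fun y => c * p y) (𝓝 0) (𝓝 0) := by
    have := (hp.const_smul c).tendsto 0
    simpa using! this
  rw [ContinuousAt, map_zero]
  exact squeeze_zero_norm hL h

variable [IsTopologicalAddGroup E]

/-- The continuous linear functional `Q (x, ·)`. -/
def functional (Q : HilbertForm E) (hQ : Continuous Q.seminorm) (x : E) : StrongDual ℝ E where
  toLinearMap := Q.form x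
  cont := LinearMap.continuous_of_abs_le_seminorm (Q.form x) hQ (Q.abs_form_le x)

theorem functional_apply (Q : HilbertForm E) (hQ : Continuous Q.seminorm) (x y : E) :
    Q.functional hQ x y = Q.form x y := rfl

/-- The seminorm of a Hilbert form is attained on its polar. -/
theorem exists_functional (Q : HilbertForm E) (hQ : Continuous Q.seminorm) (x : E) :
    ∃ f : StrongDual ℝ E, (∀ y, |f y| ≤ Q.seminorm y) ∧ f x = Q.seminorm x := by
  -- If the seminorm of x is 0, the inverse is 0 by convention and the functional is 0, as needed.
  refine ⟨(Q.seminorm x)⁻¹ • Q.functional hQ x, fun y => ?_, ?_⟩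
  · change |(Q.seminorm x)⁻¹ * Q.form x y| ≤ _
    rw [abs_mul, abs_inv, abs_of_nonneg (apply_nonneg Q.seminorm x)]
    refine (mul_le_mul_of_nonneg_left (Q.abs_form_le x y)
      (inv_nonneg.2 (apply_nonneg Q.seminorm x))).trans ?_
    rw [← mul_assoc]
    exact mul_le_of_le_one_left (apply_nonneg _ _) (inv_mul_le_one)
  · change (Q.seminorm x)⁻¹ * Q.form x x = _
    rw [← seminorm_sq, sq]
    rcases eq_or_ne (Q.seminorm x) 0 with h | h
    · simp [h]
    · field_simp

end Functionals

end HilbertForm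

/-! ### Bounded sets in a space and in its strong dual -/

theorem mem_closure_of_forall_sub_mem {X : Type*} [AddCommGroup X] [TopologicalSpace X]
    [IsTopologicalAddGroup X] {A : Set X} {x : X} (h : ∀ U ∈ 𝓝 (0 : X), ∃ a ∈ A, a - x ∈ U) :
    x ∈ closure A := by
  rw [mem_closure_iff_nhds]
  intro V hV
  obtain ⟨a, ha, haV⟩ := h ((fun y => y + x) ⁻¹' V)
    ((continuous_add_const x).continuousAt.preimage_mem_nhds (by simpa using hV))
  exact ⟨a, by simpa using haV, ha⟩

section Bounded

open Bornology

variable {E : Type*} [AddCommGroup E] [Module ℝ E] [TopologicalSpace E]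

theorem Bornology.IsVonNBounded.exists_seminorm_le {B : Set E} (hB : IsVonNBounded ℝ B)
    {p : Seminorm ℝ E} (hp : Continuous p) : ∃ M, 0 < M ∧ ∀ x ∈ B, p x ≤ M := by
  have hU : p.ball 0 1 ∈ 𝓝 (0 : E) := Seminorm.ball_mem_nhds hp one_pos
  obtain ⟨r, hr, h⟩ := (hB hU).exists_pos
  refine ⟨r, hr, fun x hx => ?_⟩
  obtain ⟨y, hy, rfl⟩ := h r (by rw [Real.norm_of_nonneg hr.le]) hx
  rw [Seminorm.mem_ball_zero] at hy
  change p (r • y) ≤ r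
  rw [map_smul_eq_mul, Real.norm_of_nonneg hr.le]
  nlinarith

theorem isVonNBounded_polar {p : Seminorm ℝ E} (hp : Continuous p) :
    IsVonNBounded ℝ {f : StrongDual ℝ E | ∀ x, |f x| ≤ p x} := by
  rw [(ContinuousLinearMap.hasBasis_nhds_zero_of_basis (Metric.nhds_basis_ball
    (x := (0 : ℝ)))).isVonNBounded_iff]
  rintro ⟨B, ε⟩ ⟨hB, hε : 0 < ε⟩
  obtain ⟨M, hM, hBM⟩ := hB.exists_seminorm_le hp
  rw [absorbs_iff_norm]
  refine ⟨M / ε + 1, fun c hc f hf => ?_⟩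
  have hc0 : 0 < ‖c‖ := lt_of_lt_of_le (by positivity) hc
  refine (Set.mem_smul_set_iff_inv_smul_mem₀ (norm_pos_iff.1 hc0) _ _).2 fun x hx => ?_
  rw [mem_ball_zero_iff, _root_.smul_apply, norm_smul, norm_inv,
    inv_mul_lt_iff₀ hc0]
  calc ‖f x‖ ≤ M := (hf x).trans (hBM x hx)
    _ = M / ε * ε := by field_simp
    _ < ‖c‖ * ε := mul_lt_mul_of_pos_right (by linarith) hε

/-- In a barrelled space, bounded sets of the strong dual are equicontinuous. -/
theorem exists_continuous_seminorm_of_isVonNBounded [ContinuousSMul ℝ E]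
    [BarrelledSpace ℝ E] {D : Set (StrongDual ℝ E)} (hD : IsVonNBounded ℝ D) :
    ∃ p : Seminorm ℝ E, Continuous p ∧ ∀ f ∈ D, ∀ x, |f x| ≤ p x := by
  let q : D → Seminorm ℝ E := fun f => (normSeminorm ℝ ℝ).comp f.1.toLinearMap
  have hb : BddAbove (Set.range q) := by
    rw [Seminorm.bddAbove_range_iff]
    intro x
    let L : StrongDual ℝ E →ₗ[ℝ] ℝ :=
      { toFun := fun f => f x, map_add' := fun _ _ => rfl, map_smul' := fun _ _ => rfl }
    have hL : Continuous ((normSeminorm ℝ ℝ).comp L) :=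
      (continuous_eval_const (F := StrongDual ℝ E) x).norm
    obtain ⟨M, -, hM⟩ := hD.exists_seminorm_le hL
    exact ⟨M, by rintro _ ⟨f, rfl⟩; exact hM f.1 f.2⟩
  -- The supremum over D is finite at each point because evaluations are continuous on the strong
  -- dual; barrelledness makes it continuous.
  refine ⟨⨆ f, q f, ?_, fun f hf x => ?_⟩
  · rw [Seminorm.coe_iSup_eq hb]
    exact Seminorm.continuous_iSup q (fun f => continuous_norm.comp f.1.continuous) hb
  exact le_ciSup hb ⟨f, hf⟩ x

/-- A continuous linear map on the strong dual is controlled by a bounded set. -/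
theorem exists_isVonNBounded_of_clm {F : Type*} [NormedAddCommGroup F] [NormedSpace ℝ F]
    (G : StrongDual ℝ E →L[ℝ] F) :
    ∃ (B : Set E) (C : ℝ), IsVonNBounded ℝ B ∧ 0 ≤ C ∧ ∀ (f : StrongDual ℝ E) (δ : ℝ), 0 < δ →
      (∀ b ∈ B, |f b| ≤ δ) → ‖G f‖ ≤ C * δ := by
  have hG : G ⁻¹' Metric.ball 0 1 ∈ 𝓝 (0 : StrongDual ℝ E) :=
    G.continuous.continuousAt.preimage_mem_nhds (by
      rw [map_zero]; exact Metric.ball_mem_nhds _ one_pos)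
  obtain ⟨⟨B, r⟩, ⟨hB, hr : 0 < r⟩, hsub⟩ := (ContinuousLinearMap.hasBasis_nhds_zero_of_basis
    (Metric.nhds_basis_ball (x := (0 : ℝ)))).mem_iff.1 hG
  refine ⟨B, 2 / r, hB, by positivity, fun f δ hδ hf => ?_⟩
  -- The factor 2 turns |f b| ≤ δ into the strict inequality of the open ball.
  have h : (r / (2 * δ)) • f ∈ G ⁻¹' Metric.ball 0 1 := hsub fun b hb => by
    rw [mem_ball_zero_iff, _root_.smul_apply, norm_smul,
      Real.norm_of_nonneg (by positivity)]
    calc r / (2 * δ) * ‖f b‖ ≤ r / (2 * δ) * δ :=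
          mul_le_mul_of_nonneg_left (hf b hb) (by positivity)
      _ = r / 2 := by field_simp
      _ < r := half_lt_self hr
  rw [Set.mem_preimage, mem_ball_zero_iff, map_smul, norm_smul,
    Real.norm_of_nonneg (by positivity), div_mul_eq_mul_div, div_lt_one (by positivity)] at h
  rw [div_mul_eq_mul_div, le_div_iff₀ hr]
  linarith

theorem norm_apply_le_of_polar {F : Type*} [NormedAddCommGroup F]
    [NormedSpace ℝ F] {T : StrongDual ℝ E →L[ℝ] F} {r : Seminorm ℝ E} {M : ℝ}
    (hT : ∀ f : StrongDual ℝ E, (∀ x, |f x| ≤ r x) → ‖T f‖ ≤ M) {f : StrongDual ℝ E} {l : ℝ}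
    (hl : 0 ≤ l) (hf : ∀ x, |f x| ≤ l * r x) : ‖T f‖ ≤ l * M := by
  rcases hl.eq_or_lt with rfl | hl
  · have : f = 0 := by
      ext x; simpa using hf x
    simp [this]
  · have := hT (l⁻¹ • f) fun x => by
      rw [_root_.smul_apply, smul_eq_mul, abs_mul, abs_of_pos (inv_pos.2 hl),
        inv_mul_le_iff₀ hl]
      exact hf x
    rwa [map_smul, norm_smul, norm_inv, Real.norm_of_nonneg hl.le, inv_mul_le_iff₀ hl] at this

end Bounded

/-! ### Tensors as operators on the strong dual -/

section ProjSeminorm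

variable {E F : Type*} [AddCommGroup E] [Module ℝ E] [AddCommGroup F] [Module ℝ F]

/-- The seminorm `p ⊗ q`, on the type of tensors that carries the projective topology. -/
def ProjTensor.seminorm (p : Seminorm ℝ E) (q : Seminorm ℝ F) : Seminorm ℝ (ProjTensor E F) :=
  projSeminorm p q

theorem ProjTensor.seminorm_tmul_le (p : Seminorm ℝ E) (q : Seminorm ℝ F) (x : E) (y : F) :
    ProjTensor.seminorm p q (ProjTensor.tmul x y) ≤ p x * q y :=
  csInf_le (projSums_bddBelow p q _) ⟨[(x, y)], by simp [ProjTensor.tmul], by simp⟩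

end ProjSeminorm

section TensorOp

open Bornology

variable {E F : Type*} [AddCommGroup E] [Module ℝ E] [TopologicalSpace E]
  [ContinuousSMul ℝ E] [NormedAddCommGroup F] [NormedSpace ℝ F]

/-- The rank one operator `f ↦ f x • y` on the strong dual. -/
def rankOneDual (x : E) (y : F) : StrongDual ℝ E →L[ℝ] F where
  toFun f := f x • y
  map_add' _ _ := by simp [add_smul]
  map_smul' _ _ := by simp [mul_smul]
  cont := (continuous_eval_const x).smul continuous_const

variable (E F) in
/-- The canonical linear map `E ⊗ F → L(E', F)`. -/
def tensorOp : ProjTensor E F →ₗ[ℝ] (StrongDual ℝ E →L[ℝ] F) :=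
  (TensorProduct.lift (LinearMap.mk₂ ℝ rankOneDual
    (fun x x' y => by ext f; simp [rankOneDual, add_smul])
    (fun c x y => by ext f; simp [rankOneDual, mul_smul])
    (fun x y y' => by ext f; simp [rankOneDual])
    (fun c x y => by ext f; simp [rankOneDual, smul_smul, mul_comm])) :
      E ⊗[ℝ] F →ₗ[ℝ] (StrongDual ℝ E →L[ℝ] F))

theorem tensorOp_tmul (x : E) (y : F) (f : StrongDual ℝ E) :
    tensorOp E F (ProjTensor.tmul x y) f = f x • y := rfl

/-- The triangle inequality gives the bound for each representation of θ; then take the infimum. -/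
theorem norm_tensorOp_le {p : Seminorm ℝ E} {f : StrongDual ℝ E} (hf : ∀ x, |f x| ≤ p x)
    (θ : ProjTensor E F) :
    ‖tensorOp E F θ f‖ ≤ ProjTensor.seminorm p (normSeminorm ℝ F) θ := by
  refine le_csInf (projSums_nonempty p _ θ) ?_
  rintro _ ⟨l, rfl, rfl⟩
  induction l with
  | nil =>
    change ‖tensorOp E F 0 f‖ ≤ 0
    simp
  | cons z l ih =>
    simp only [List.map_cons, List.sum_cons]
    have h := map_add (tensorOp E F) (ProjTensor.tmul z.1 z.2)
      ((l.map fun z => z.1 ⊗ₜ[ℝ] z.2).sum : E ⊗[ℝ] F)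
    calc _ = ‖f z.1 • z.2 + tensorOp E F (l.map fun z => z.1 ⊗ₜ[ℝ] z.2).sum f‖ :=
          congrArg (fun T : StrongDual ℝ E →L[ℝ] F => ‖T f‖) h
      _ ≤ _ := (norm_add_le _ _).trans (add_le_add ?_ ih)
    rw [norm_smul]
    exact mul_le_mul_of_nonneg_right (hf z.1) (norm_nonneg _)

variable [IsTopologicalAddGroup E]

/-- A tensor agrees with its finite orthonormal expansion up to a tensor of zero seminorm. -/
theorem exists_projSeminorm_sub_eq_zero {Q : HilbertForm E} (hQ : Continuous Q.seminorm)
    {p : Seminorm ℝ E} (hpQ : ∀ x, Q.form x x = 0 → p x = 0) (q : Seminorm ℝ F)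
    (θ : ProjTensor E F) :
    ∃ t : Finset E, ∀ s : Finset E,
      (∀ x ∈ t, Q.form (Q.resid s x) (Q.resid s x) = 0) →
      ProjTensor.seminorm p q
        (θ - ∑ e ∈ s, ProjTensor.tmul e (tensorOp E F θ (Q.functional hQ e))) = 0 := by
  classical
  have hadd : ∀ (x : E) (y y' : F), ProjTensor.tmul x (y + y') =
      ProjTensor.tmul x y + ProjTensor.tmul x y' := fun x y y' => TensorProduct.tmul_add x y y'
  induction θ using TensorProduct.induction_on with
  | zero =>
    refine ⟨∅, fun s _ => ?_⟩
    have h0 : ∀ x : E, ProjTensor.tmul x (0 : F) = 0 := fun x => TensorProduct.tmul_zero F x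
    have : tensorOp E F (0 : E ⊗[ℝ] F) = 0 := map_zero (tensorOp E F)
    simp only [this, _root_.zero_apply, h0, Finset.sum_const_zero]
    exact (congrArg _ (sub_zero (0 : ProjTensor E F))).trans (map_zero _)
  | tmul x y =>
    refine ⟨{x}, fun s hs => ?_⟩
    -- Moving scalars across the tensor leaves the residual of x in the first factor, where p
    -- vanishes.
    have h1 : (x ⊗ₜ[ℝ] y : E ⊗[ℝ] F) - ∑ e ∈ s, e ⊗ₜ[ℝ] (Q.form e x • y) =
        Q.resid s x ⊗ₜ[ℝ] y := by
      rw [HilbertForm.resid, TensorProduct.sub_tmul, TensorProduct.sum_tmul]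
      simp [TensorProduct.smul_tmul]
    refine le_antisymm ?_ (apply_nonneg _ _)
    refine (congrArg _ h1).le.trans ((ProjTensor.seminorm_tmul_le p q _ _).trans ?_)
    rw [hpQ _ (hs x (by simp)), zero_mul]
  | add a b ha hb =>
    obtain ⟨t, ht⟩ := ha
    obtain ⟨u, hu⟩ := hb
    -- Quantifying over all s lets both induction hypotheses be applied to one common s.
    refine ⟨t ∪ u, fun s hs => le_antisymm ?_ (apply_nonneg _ _)⟩
    have h1 := ht s fun x hx => hs x (Finset.mem_union_left u hx)
    have h2 := hu s fun x hx => hs x (Finset.mem_union_right t hx)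
    have h3 : ∀ f, tensorOp E F (a + b) f = tensorOp E F a f + tensorOp E F b f := fun f =>
      congrArg (fun T : StrongDual ℝ E →L[ℝ] F => T f) (map_add (tensorOp E F) a b)
    simp only [h3, hadd, Finset.sum_add_distrib]
    refine (congrArg _ (add_sub_add_comm (α := ProjTensor E F) a b _ _)).le.trans
      ((map_add_le_add _ _ _).trans ?_)
    exact (congrArg₂ (· + ·) h1 h2).le.trans (add_zero 0).le

/-- The nuclear estimate: the projective seminorms are dominated by the operator seminorms. -/
theorem exists_projSeminorm_le (hE : IsNuclearSpace E) {p : Seminorm ℝ E} (hp : Continuous p)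
    {q : Seminorm ℝ F} (hq : Continuous q) :
    ∃ (r : Seminorm ℝ E) (C : ℝ), Continuous r ∧ 0 ≤ C ∧ ∀ (θ : ProjTensor E F) (M : ℝ),
      (∀ f : StrongDual ℝ E, (∀ x, |f x| ≤ r x) → ‖tensorOp E F θ f‖ ≤ M) →
      ProjTensor.seminorm p q θ ≤ C * M := by
  obtain ⟨P, Q, R, A, hA, hpP, hPQ, hQR, hR⟩ := HilbertForm.exists_of_continuous hE p hp
  obtain ⟨K, hK, hqK⟩ := Seminorm.bound_of_continuous_normedSpace q hq
  obtain ⟨C₁, hC₁⟩ := hPQ.exists_sum_le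
  obtain ⟨C₂, hC₂⟩ := hQR.bound
  have hQ : Continuous Q.seminorm := Seminorm.continuous_of_le hR hQR.le
  have hC₁0 : 0 ≤ C₁ := by simpa using hC₁ ∅ (fun a => by simp)
  have hC₂0 : 0 ≤ C₂ := by
    obtain ⟨l, -, h, -⟩ := hC₂ ∅ (fun a => by simp)
    simpa using h
  refine ⟨R.seminorm, A * K * (C₁ + C₂), hR, by positivity, fun θ M hM => ?_⟩
  have hM0 : 0 ≤ M := (norm_nonneg _).trans (hM 0 fun x => by simp)
  obtain ⟨t, ht⟩ := exists_projSeminorm_sub_eq_zero (F := F) hQ (p := p) (fun x hx =>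
    le_antisymm ((hpP x).trans (by
      rw [HilbertForm.seminorm_eq_zero_of_form_eq_zero hPQ.le hx, mul_zero])) (apply_nonneg _ _)) q θ
  obtain ⟨s, hs, hst⟩ := Q.exists_isOrtho_resid_eq_zero t
  obtain ⟨l, hl, hlC, hle⟩ := hC₂ s hs.isBessel
  set σ := ∑ e ∈ s, ProjTensor.tmul e (tensorOp E F θ (Q.functional hQ e)) with hσ
  set N : Seminorm ℝ (ProjTensor E F) := ProjTensor.seminorm p q
  calc N θ = N ((θ - σ) + σ) := by rw [sub_add_cancel]
    _ ≤ N (θ - σ) + N σ := map_add_le_add _ _ _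
    _ = N σ := by rw [hσ, ht s hst, zero_add]
    _ ≤ ∑ e ∈ s, N (ProjTensor.tmul e (tensorOp E F θ (Q.functional hQ e))) :=
        Finset.le_sum_of_subadditive N (map_zero N).le (map_add_le_add N) _ _
    _ ≤ ∑ e ∈ s, A * K * M * (P.form e e + l e ^ 2) := Finset.sum_le_sum fun e he => by
        refine (ProjTensor.seminorm_tmul_le p q _ _).trans ?_
        have h1 : q (tensorOp E F θ (Q.functional hQ e)) ≤ K * (l e * M) :=
          (hqK _).trans (mul_le_mul_of_nonneg_left
            (norm_apply_le_of_polar hM (hl e) (hle e he)) hK.le)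
        -- Splits the product into two sums: P ≤ Q controls ∑ P(e, e) by C₁, and Q ≤ R controls ∑ l
        -- e² by C₂.
        have h2 : P.seminorm e * l e ≤ P.form e e + l e ^ 2 := by
          rw [← HilbertForm.seminorm_sq]
          nlinarith [sq_nonneg (P.seminorm e - l e), sq_nonneg (P.seminorm e), sq_nonneg (l e)]
        calc p e * q _ ≤ (A * P.seminorm e) * (K * (l e * M)) :=
              mul_le_mul (hpP e) h1 (apply_nonneg _ _) (mul_nonneg hA (apply_nonneg _ _))
          _ = A * K * M * (P.seminorm e * l e) := by ring
          _ ≤ _ := mul_le_mul_of_nonneg_left h2 (by positivity)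
    _ = A * K * M * (∑ e ∈ s, P.form e e + ∑ e ∈ s, l e ^ 2) := by
        rw [← Finset.mul_sum, Finset.sum_add_distrib]
    _ ≤ A * K * M * (C₁ + C₂) :=
        mul_le_mul_of_nonneg_left (add_le_add (hC₁ s hs.isBessel) hlC) (by positivity)
    _ = A * K * (C₁ + C₂) * M := by ring

/-- One direction puts a strongly bounded D into the polar of some p. The other is the nuclear
estimate, read on the polar of r, which is strongly bounded. -/
theorem isInducing_tensorOp [BarrelledSpace ℝ E] (hE : IsNuclearSpace E) :
    Topology.IsInducing (tensorOp E F) := by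
  rw [IsTopologicalAddGroup.isInducing_iff_nhds_zero]
  have hbasis := ContinuousLinearMap.hasBasis_nhds_zero_of_basis (E := StrongDual ℝ E)
    (σ := RingHom.id ℝ) (Metric.nhds_basis_ball (x := (0 : F)))
  refine le_antisymm ?_ ?_
  · rw [← Filter.tendsto_iff_comap, hbasis.tendsto_right_iff]
    rintro ⟨D, ε⟩ ⟨hD, hε : 0 < ε⟩
    obtain ⟨p, hp, hDp⟩ := exists_continuous_seminorm_of_isVonNBounded hD
    have hc : Continuous (ProjTensor.seminorm p (normSeminorm ℝ F)) :=
      ProjTensor.withSeminorms.continuous_seminorm (⟨p, hp⟩, ⟨normSeminorm ℝ F, continuous_norm⟩)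
    have := hc.tendsto 0
    rw [map_zero] at this
    filter_upwards [this.eventually_lt_const hε] with θ hθ f hf
    rw [mem_ball_zero_iff]
    exact (norm_tensorOp_le (hDp f hf) θ).trans_lt hθ
  · rw [(SeminormFamily.withSeminorms_iff_nhds_eq_iInf _).1
      (ProjTensor.withSeminorms (E := E) (F := F))]
    refine le_iInf fun i => ?_
    rw [← Filter.tendsto_iff_comap]
    obtain ⟨r, C, hr, hC, h⟩ := exists_projSeminorm_le (F := F) hE i.1.2 i.2.2
    rw [Metric.nhds_basis_ball.tendsto_right_iff]
    intro ε hε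
    have hδ : 0 < ε / (C + 1) := by positivity
    have hmem := hbasis.mem_of_mem (i := (_, ε / (C + 1))) ⟨isVonNBounded_polar hr, hδ⟩
    filter_upwards [Filter.preimage_mem_comap hmem] with θ hθ
    rw [mem_ball_zero_iff, Real.norm_of_nonneg (apply_nonneg _ _)]
    refine (h θ _ fun f hf => (mem_ball_zero_iff.1 (hθ f hf)).le).trans_lt ?_
    rw [mul_div_assoc', div_lt_iff₀ (by positivity)]
    linarith

/-- G is controlled by a bounded set B on which the finite expansion along s is uniformly accurate.
Replacing f by ∑ f(e) Q(e, ·) changes f on B only by its values on residuals, and G of this sum is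
the operator of ∑ e ⊗ G(Q(e, ·)). -/
theorem denseRange_tensorOp [BarrelledSpace ℝ E] (hE : IsNuclearSpace E) :
    DenseRange (tensorOp E F) := by
  intro G
  refine mem_closure_of_forall_sub_mem fun U hU' => ?_
  obtain ⟨⟨D, ε⟩, ⟨hD, hε : 0 < ε⟩, hsub⟩ := (ContinuousLinearMap.hasBasis_nhds_zero_of_basis
    (Metric.nhds_basis_ball (x := (0 : F)))).mem_iff.1 hU'
  obtain ⟨p, hp, hDp⟩ := exists_continuous_seminorm_of_isVonNBounded hD
  obtain ⟨P, Q, R, A, hA, hpP, hPQ, hQR, hR⟩ := HilbertForm.exists_of_continuous hE p hp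
  have hQ : Continuous Q.seminorm := Seminorm.continuous_of_le hR hQR.le
  obtain ⟨B, C, hB, hC, hG⟩ := exists_isVonNBounded_of_clm G
  obtain ⟨M, -, hM⟩ := hB.exists_seminorm_le hQ
  have hδ : 0 < ε / (C * (A + 1) + 1) := by positivity
  set δ := ε / (C * (A + 1) + 1) with hδdef
  obtain ⟨s, hs⟩ := hPQ.exists_approx M hδ
  set θ := ∑ e ∈ s, ProjTensor.tmul e (G (Q.functional hQ e)) with hθ
  refine ⟨tensorOp E F θ, ⟨θ, rfl⟩, hsub fun f hf => ?_⟩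
  have h1 : tensorOp E F θ f = G (∑ e ∈ s, f e • Q.functional hQ e) := by
    simp [hθ, tensorOp_tmul, map_sum]
  rw [mem_ball_zero_iff, _root_.sub_apply, h1, ← map_sub, ← norm_neg, ← map_neg,
    neg_sub]
  -- The additional δ keeps the bound positive when A = 0.
  have h2 : ∀ b ∈ B, |(f - ∑ e ∈ s, f e • Q.functional hQ e) b| ≤ A * δ + δ := fun b hb => by
    have h3 : (f - ∑ e ∈ s, f e • Q.functional hQ e) b = f (Q.resid s b) := by
      simp [HilbertForm.resid, HilbertForm.functional_apply, mul_comm]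
    rw [h3]
    have h4 := mul_le_mul_of_nonneg_left (hs b (hM b hb)) hA
    linarith [hDp f hf (Q.resid s b), hpP (Q.resid s b)]
  refine (hG _ _ (by positivity) h2).trans_lt ?_
  calc C * (A * δ + δ) < (C * (A + 1) + 1) * δ := by linarith
    _ = ε := by rw [hδdef]; field_simp

end TensorOp

/-! ### Weakly bounded sets in nuclear spaces -/

section Nuclear

open Bornology

variable {E : Type*} [AddCommGroup E] [Module ℝ E] [TopologicalSpace E] [IsTopologicalAddGroup E]

/-- Banach-Steinhaus on the Hilbert space of P: the points of B act as functionals on it, and each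
vector v yields a continuous functional ⟨v, ·⟩ on E, so they are pointwise bounded. -/
theorem HilbertForm.bddAbove_of_weakly_bounded (P : HilbertForm E) (hP : Continuous P.seminorm)
    {B : Set E} (hB : ∀ f : StrongDual ℝ E, ∃ C : ℝ, ∀ b ∈ B, |f b| ≤ C) :
    ∃ M : ℝ, ∀ b ∈ B, P.seminorm b ≤ M := by
  obtain ⟨M, hM⟩ := banach_steinhaus (𝕜 := ℝ) (𝕜₂ := ℝ) (E := P.Hilbert) (F := ℝ)
    (g := fun b : B => innerSL ℝ (P.toHilbert b)) fun v => by
      let L : StrongDual ℝ E :=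
        ⟨(innerSL ℝ v).toLinearMap ∘ₗ P.toHilbert,
          LinearMap.continuous_of_abs_le_seminorm _ hP (c := ‖v‖) fun x => by
            rw [← norm_toHilbert]
            exact abs_real_inner_le_norm v (P.toHilbert x)⟩
      obtain ⟨C, hC⟩ := hB L
      refine ⟨C, fun b => ?_⟩
      rw [innerSL_apply_apply, real_inner_comm]
      exact hC b b.2
  refine ⟨M, fun b hb => ?_⟩
  rw [← norm_toHilbert, ← innerSL_apply_norm (𝕜 := ℝ)]
  exact hM ⟨b, hb⟩

/-- Mackey's theorem: in a nuclear space weakly bounded sets are bounded. -/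
theorem isVonNBounded_of_weakly_bounded (hE : IsNuclearSpace E) {B : Set E}
    (hB : ∀ f : StrongDual ℝ E, ∃ C : ℝ, ∀ b ∈ B, |f b| ≤ C) : IsVonNBounded ℝ B := by
  obtain ⟨S, hS, -⟩ := hE
  rw [hS.isVonNBounded_iff_seminorm_bounded]
  intro i
  obtain ⟨M, hM⟩ := i.1.bddAbove_of_weakly_bounded (hS.continuous_seminorm i) hB
  exact ⟨|M| + 1, by positivity, fun x hx =>
    (hM x hx).trans_lt ((le_abs_self M).trans_lt (lt_add_one _))⟩

/-- A finite supremum of Hilbertian seminorms need not be Hilbertian, whereas `exists_functional`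
requires a single form. -/
theorem IsNuclearSpace.exists_ball_subset (hE : IsNuclearSpace E) {V : Set E}
    (hV : V ∈ 𝓝 (0 : E)) :
    ∃ (P : HilbertForm E) (r : ℝ), Continuous P.seminorm ∧ 0 < r ∧ P.seminorm.ball 0 r ⊆ V := by
  obtain ⟨S, hS, -⟩ := id hE
  obtain ⟨s, r, hr, hsub⟩ := (hS.mem_nhds_iff 0 V).1 hV
  obtain ⟨P, Q, R, A, hA, hP, hPQ, hQR, hR⟩ := HilbertForm.exists_of_continuous hE
    (s.sup fun i : S => i.1.seminorm)
    (Seminorm.continuous_finsetSup fun i _ => hS.continuous_seminorm i)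
  refine ⟨P, r / (A + 1), Seminorm.continuous_of_le hR (hPQ.le.trans hQR.le), by positivity,
    fun x hx => hsub ?_⟩
  rw [Seminorm.mem_ball_zero] at hx ⊢
  rw [lt_div_iff₀ (by positivity)] at hx
  linarith [hP x, apply_nonneg P.seminorm x]

end Nuclear

/-! ### Spaces of functions determined by scalar functions -/

section Processes

open Bornology Filter

variable {Z F Φ : Type*} [NormedAddCommGroup F] [NormedSpace ℝ F]
  [AddCommGroup Φ] [Module ℝ Φ] [UniformSpace Φ]

/-- The normed space `F` is, via `c`, a space of functions on `Z` with the supremum norm, and `W`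
is the space of functions `Z → Φ` that belong to `F` weakly. -/
structure IsWeakModel (c : F →ₗ[ℝ] Z → ℝ) (W : Submodule ℝ (Z →ᵤ Φ)) : Prop where
  norm_le_iff : ∀ (a : F) {C : ℝ}, 0 ≤ C → (‖a‖ ≤ C ↔ ∀ z, |c a z| ≤ C)
  mem_iff : ∀ H : Z →ᵤ Φ, H ∈ W ↔
    ∀ f : StrongDual ℝ Φ, ∃ a : F, ∀ z, c a z = f (UniformFun.toFun H z)

theorem Completion.map_add_of_continuous {X Y : Type*} [UniformSpace X] [AddCommGroup X]
    [IsUniformAddGroup X] [AddCommGroup Y] [TopologicalSpace Y] [IsTopologicalAddGroup Y]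
    [T2Space Y] {g : Completion X → Y} (hg : Continuous g)
    (h : ∀ x y : X, g ((x + y : X) : Completion X) = g x + g y) (a b : Completion X) :
    g (a + b) = g a + g b := by
  induction a, b using Completion.induction_on₂ with
  | hp =>
    exact isClosed_eq (hg.comp continuous_add)
      ((hg.comp continuous_fst).add (hg.comp continuous_snd))
  | ih a b => rw [← Completion.coe_add, h]

namespace IsWeakModel

theorem ext {c : F →ₗ[ℝ] Z → ℝ} {W : Submodule ℝ (Z →ᵤ Φ)} (hc : IsWeakModel c W) {a b : F}
    (h : ∀ z, c a z = c b z) : a = b := by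
  rw [← sub_eq_zero, ← norm_le_zero_iff, hc.norm_le_iff _ le_rfl]
  intro z
  simp [h z]

variable {c : F →ₗ[ℝ] Z → ℝ} {W : Submodule ℝ (Z →ᵤ Φ)} (hc : IsWeakModel c W)

/-- The operator `f ↦ ⟨f, H⟩` of `H ∈ W`. -/
def opLinear (H : W) : StrongDual ℝ Φ →ₗ[ℝ] F where
  toFun f := ((hc.mem_iff H).1 H.2 f).choose
  map_add' f g := hc.ext fun z => by
    rw [map_add, Pi.add_apply, ((hc.mem_iff H).1 H.2 _).choose_spec,
      ((hc.mem_iff H).1 H.2 f).choose_spec, ((hc.mem_iff H).1 H.2 g).choose_spec]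
    rfl
  map_smul' r f := hc.ext fun z => by
    rw [map_smul, Pi.smul_apply, ((hc.mem_iff H).1 H.2 _).choose_spec,
      ((hc.mem_iff H).1 H.2 f).choose_spec]
    rfl

theorem opLinear_apply (H : W) (f : StrongDual ℝ Φ) (z : Z) :
    c (hc.opLinear H f) z = f (UniformFun.toFun H.1 z) :=
  ((hc.mem_iff H).1 H.2 f).choose_spec z

variable [IsUniformAddGroup Φ]

/-- The range of H is weakly bounded, hence bounded, and ‖⟨f, H⟩‖ is the supremum of |f| over it. -/
theorem continuous_opLinear (hΦ : IsNuclearSpace Φ) (H : W) : Continuous (hc.opLinear H) := by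
  have hB : IsVonNBounded ℝ (Set.range (UniformFun.toFun H.1)) :=
    isVonNBounded_of_weakly_bounded hΦ fun f => by
      refine ⟨‖hc.opLinear H f‖, ?_⟩
      rintro _ ⟨z, rfl⟩
      rw [← hc.opLinear_apply]
      exact (hc.norm_le_iff _ (norm_nonneg _)).1 le_rfl z
  refine continuous_of_continuousAt_zero (hc.opLinear H) ?_
  rw [ContinuousAt, map_zero, Metric.nhds_basis_closedBall.tendsto_right_iff]
  intro ε hε
  filter_upwards [(ContinuousLinearMap.hasBasis_nhds_zero_of_basis
    (Metric.nhds_basis_ball (x := (0 : ℝ)))).mem_of_mem (i := (_, ε)) ⟨hB, hε⟩] with f hf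
  rw [mem_closedBall_zero_iff, hc.norm_le_iff _ hε.le]
  intro z
  rw [hc.opLinear_apply]
  exact (mem_ball_zero_iff.1 (hf _ (Set.mem_range_self z))).le

/-- The linear map `H ↦ [f ↦ ⟨f, H⟩]` from `W` to `L_b(Φ', F)`. -/
def op (hΦ : IsNuclearSpace Φ) : W →ₗ[ℝ] (StrongDual ℝ Φ →L[ℝ] F) where
  toFun H := ⟨hc.opLinear H, hc.continuous_opLinear hΦ H⟩
  map_add' H K := by
    ext1 f
    refine hc.ext fun z => ?_
    rw [_root_.add_apply, map_add, Pi.add_apply]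
    exact (hc.opLinear_apply (H + K) f z).trans ((map_add f _ _).trans
      (congrArg₂ (· + ·) (hc.opLinear_apply H f z) (hc.opLinear_apply K f z)).symm)
  map_smul' r H := by
    ext1 f
    refine hc.ext fun z => ?_
    rw [RingHom.id_apply, _root_.smul_apply, map_smul, Pi.smul_apply]
    exact (hc.opLinear_apply (r • H) f z).trans ((map_smul f r _).trans
      (congrArg (r • ·) (hc.opLinear_apply H f z)).symm)

theorem op_apply (hΦ : IsNuclearSpace Φ) (H : W) (f : StrongDual ℝ Φ) (z : Z) :
    c (hc.op hΦ H f) z = f (UniformFun.toFun H.1 z) :=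
  hc.opLinear_apply H f z

variable [ContinuousSMul ℝ Φ]

instance : IsUniformAddGroup W := inferInstanceAs (IsUniformAddGroup W.toAddSubgroup)

theorem isInducing_op [BarrelledSpace ℝ Φ] (hΦ : IsNuclearSpace Φ) :
    Topology.IsInducing (hc.op hΦ) := by
  rw [IsTopologicalAddGroup.isInducing_iff_nhds_zero]
  have hbasis := ContinuousLinearMap.hasBasis_nhds_zero_of_basis (E := StrongDual ℝ Φ)
    (σ := RingHom.id ℝ) (Metric.nhds_basis_ball (x := (0 : F)))
  have hdom : (𝓝 (0 : W)) = comap Subtype.val (𝓝 (0 : Z →ᵤ Φ)) := nhds_subtype_eq_comap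
  refine le_antisymm ?_ ?_
  · rw [← tendsto_iff_comap, hbasis.tendsto_right_iff]
    rintro ⟨D, ε⟩ ⟨hD, hε : 0 < ε⟩
    obtain ⟨p, hp, hDp⟩ := exists_continuous_seminorm_of_isVonNBounded hD
    -- Half of ε, since the supremum over z may reach the bound.
    have hV : p.ball 0 (ε / 2) ∈ 𝓝 (0 : Φ) := Seminorm.ball_mem_nhds hp (half_pos hε)
    have hmem : {H : Z →ᵤ Φ | ∀ z, UniformFun.toFun H z ∈ p.ball 0 (ε / 2)} ∈
        𝓝 (0 : Z →ᵤ Φ) := UniformFun.hasBasis_nhds_zero.mem_of_mem hV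
    rw [hdom]
    filter_upwards [preimage_mem_comap hmem] with H hH f hf
    rw [mem_ball_zero_iff]
    refine ((hc.norm_le_iff _ (half_pos hε).le).2 fun z => ?_).trans_lt (half_lt_self hε)
    rw [hc.op_apply]
    have := hH z
    rw [Seminorm.mem_ball_zero] at this
    exact (hDp f hf _).trans this.le
  · rw [hdom, ← tendsto_iff_comap, UniformFun.hasBasis_nhds_zero.tendsto_right_iff]
    intro V hV
    obtain ⟨P, r, hP, hr, hsub⟩ := hΦ.exists_ball_subset hV
    filter_upwards [preimage_mem_comap
      (hbasis.mem_of_mem (i := (_, r)) ⟨isVonNBounded_polar hP, hr⟩)] with H hH z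
    refine hsub ((P.seminorm.mem_ball_zero).2 ?_)
    obtain ⟨f, hf, hfz⟩ := P.exists_functional hP (UniformFun.toFun H.1 z)
    refine hfz.symm.le.trans_lt (((le_abs_self _).trans ?_).trans_lt
      (mem_ball_zero_iff.1 (hH f hf)))
    rw [← hc.op_apply hΦ]
    exact (hc.norm_le_iff _ (norm_nonneg _)).1 le_rfl z

theorem range_tensorOp_subset (hΦ : IsNuclearSpace Φ) :
    Set.range (tensorOp Φ F) ⊆ Set.range (hc.op hΦ) := by
  rintro _ ⟨θ, rfl⟩
  induction θ using TensorProduct.induction_on with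
  | zero => exact ⟨0, (map_zero _).trans (map_zero (tensorOp Φ F)).symm⟩
  | tmul φ h =>
    have hmem : UniformFun.ofFun (fun z => c h z • φ) ∈ W := (hc.mem_iff _).2 fun f =>
      ⟨f φ • h, fun z => by simp [mul_comm]⟩
    refine ⟨⟨_, hmem⟩, ?_⟩
    ext1 f
    refine hc.ext fun z => (hc.op_apply hΦ _ f z).trans ?_
    change f (c h z • φ) = c (f φ • h) z
    simp [mul_comm]
  | add a b ha hb =>
    obtain ⟨H, hH⟩ := ha
    obtain ⟨K, hK⟩ := hb
    refine ⟨H + K, ?_⟩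
    rw [map_add, hH, hK]
    exact (map_add (tensorOp Φ F) a b).symm

theorem isUniformInducing_op [BarrelledSpace ℝ Φ] (hΦ : IsNuclearSpace Φ) :
    IsUniformInducing (hc.op hΦ) :=
  AddMonoidHom.isUniformInducing_of_isInducing (hc.isInducing_op hΦ)

variable [CompleteSpace W] [BarrelledSpace ℝ Φ]

/-- The range is complete, hence closed, and contains the dense range of `tensorOp`. -/
theorem surjective_op (hΦ : IsNuclearSpace Φ) : Function.Surjective (hc.op hΦ) := by
  have hcl : IsClosed (Set.range (hc.op hΦ)) :=
    ((completeSpace_iff_isComplete_range (hc.isUniformInducing_op hΦ)).1 inferInstance).isClosed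
  rw [← Set.range_eq_univ, ← hcl.closure_eq]
  exact ((denseRange_tensorOp hΦ).mono (hc.range_tensorOp_subset hΦ)).closure_eq

/-- The isomorphism `W ≃ L_b(Φ', F)`. -/
def equiv [T2Space Φ] (hΦ : IsNuclearSpace Φ) : W ≃L[ℝ] (StrongDual ℝ Φ →L[ℝ] F) where
  toLinearEquiv := LinearEquiv.ofBijective (hc.op hΦ)
    ⟨(hc.isInducing_op hΦ).injective, hc.surjective_op hΦ⟩
  continuous_toFun := (hc.isInducing_op hΦ).continuous
  continuous_invFun := (hc.isInducing_op hΦ).continuous_iff.2 <|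
    continuous_id.congr fun G => (LinearEquiv.apply_symm_apply (LinearEquiv.ofBijective
      (hc.op hΦ) ⟨(hc.isInducing_op hΦ).injective, hc.surjective_op hΦ⟩) G).symm

theorem apply_equiv_symm [T2Space Φ] (hΦ : IsNuclearSpace Φ) (G : StrongDual ℝ Φ →L[ℝ] F)
    (f : StrongDual ℝ Φ) (z : Z) :
    f (UniformFun.toFun ((hc.equiv hΦ).symm G).1 z) = c (G f) z := by
  rw [← hc.op_apply hΦ]
  exact congrArg (fun T : StrongDual ℝ Φ →L[ℝ] F => c (T f) z)
    ((hc.equiv hΦ).apply_symm_apply G)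

/-- The space `L_b(Φ', F)` as a completion of `Φ ⊗ F`. -/
def tensorCompletion (hΦ : IsNuclearSpace Φ) : AbstractCompletion (ProjTensor Φ F) where
  space := StrongDual ℝ Φ →L[ℝ] F
  coe := tensorOp Φ F
  uniformStruct := inferInstance
  -- Completeness is inherited from W through `op`.
  complete := ((hc.isUniformInducing_op hΦ).completeSpace_congr (hc.surjective_op hΦ)).1
    inferInstance
  separation := inferInstance
  isUniformInducing := AddMonoidHom.isUniformInducing_of_isInducing (isInducing_tensorOp hΦ)
  dense := denseRange_tensorOp hΦ

/-- The uniform isomorphism of the completed projective tensor product with `L_b(Φ', F)`. -/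
def tensorUniformEquiv (hΦ : IsNuclearSpace Φ) :
    CompletedProjTensor Φ F ≃ᵤ (StrongDual ℝ Φ →L[ℝ] F) :=
  Completion.cPkg.compareEquiv (hc.tensorCompletion hΦ)

theorem tensorUniformEquiv_coe (hΦ : IsNuclearSpace Φ) (θ : ProjTensor Φ F) :
    hc.tensorUniformEquiv hΦ (θ : CompletedProjTensor Φ F) = tensorOp Φ F θ :=
  Completion.cPkg.compare_coe (hc.tensorCompletion hΦ) θ

/-- The isomorphism of the completed projective tensor product with `L_b(Φ', F)`. -/
def tensorEquiv (hΦ : IsNuclearSpace Φ) :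
    CompletedProjTensor Φ F ≃L[ℝ] (StrongDual ℝ Φ →L[ℝ] F) where
  toFun := hc.tensorUniformEquiv hΦ
  invFun := (hc.tensorUniformEquiv hΦ).symm
  left_inv := (hc.tensorUniformEquiv hΦ).left_inv
  right_inv := (hc.tensorUniformEquiv hΦ).right_inv
  map_add' := Completion.map_add_of_continuous (hc.tensorUniformEquiv hΦ).continuous fun a b => by
    rw [tensorUniformEquiv_coe, tensorUniformEquiv_coe, tensorUniformEquiv_coe, map_add]
  map_smul' r a := by
    have hcont := (hc.tensorUniformEquiv hΦ).continuous
    induction a using Completion.induction_on with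
    | hp => exact isClosed_eq (hcont.comp (continuous_const_smul r)) (hcont.const_smul r)
    | ih a =>
      rw [← Completion.coe_smul, tensorUniformEquiv_coe, tensorUniformEquiv_coe, map_smul,
        RingHom.id_apply]
  continuous_toFun := (hc.tensorUniformEquiv hΦ).continuous
  continuous_invFun := (hc.tensorUniformEquiv hΦ).symm.continuous

theorem tensorEquiv_tmul (hΦ : IsNuclearSpace Φ) (φ : Φ) (h : F) (f : StrongDual ℝ Φ) :
    hc.tensorEquiv hΦ ((ProjTensor.tmul φ h : ProjTensor Φ F) : CompletedProjTensor Φ F) f =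
      f φ • h :=
  congrArg (fun T : StrongDual ℝ Φ →L[ℝ] F => T f)
    (hc.tensorUniformEquiv_coe hΦ (ProjTensor.tmul φ h))

end IsWeakModel

end Processes

/-! ### Bounded predictable processes -/

section Predictable

open Filter

variable {Ω : Type*} {m : MeasurableSpace Ω} {𝓕 : Filtration ℝ≥0 m}
  {Φ : Type*} [AddCommGroup Φ] [Module ℝ Φ] [UniformSpace Φ] [IsUniformAddGroup Φ]
  [ContinuousSMul ℝ Φ]

theorem isClosed_weaklyBoundedPredictable :
    IsClosed (weaklyBoundedPredictable 𝓕 Φ : Set ((ℝ≥0 × Ω) →ᵤ Φ)) := by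
  refine isClosed_of_closure_subset fun H hH f => ?_
  have key : ∀ ε > 0, ∃ K ∈ weaklyBoundedPredictable 𝓕 Φ, ∀ z,
      |f (UniformFun.toFun H z) - f (UniformFun.toFun K z)| < ε := fun ε hε => by
    have hV : {w : Φ × Φ | |f w.1 - f w.2| < ε} ∈ uniformity Φ :=
      f.uniformContinuous (Metric.dist_mem_uniformity hε)
    obtain ⟨K, hK, hKW⟩ := mem_closure_iff_nhds.1 hH _
      ((UniformFun.hasBasis_nhds _ _ H).mem_of_mem hV)
    exact ⟨K, hKW, fun z => hK z⟩
  refine ⟨?_, ?_⟩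
  -- The sequence depends on f: only the scalar functions f ∘ K n must converge, so Φ need not be
  -- metrizable.
  · choose K hK hKz using fun n : ℕ => key (1 / (n + 1)) Nat.one_div_pos_of_nat
    refine @measurable_of_tendsto_metrizable _ _ 𝓕.predictable _ _ _ _
      (fun n z => f (UniformFun.toFun (K n) z)) _ (fun n => (hK n f).1) ?_
    rw [tendsto_pi_nhds]
    intro z
    rw [tendsto_iff_dist_tendsto_zero]
    refine squeeze_zero (fun _ => dist_nonneg) (fun n => ?_) tendsto_one_div_add_atTop_nhds_zero_nat
    rw [dist_comm, Real.dist_eq]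
    exact (hKz n z).le
  · obtain ⟨K, hK, hKz⟩ := key 1 one_pos
    obtain ⟨C, hC⟩ := (hK f).2
    refine ⟨C + 1, fun z => ?_⟩
    have h1 := abs_sub_abs_le_abs_sub (f (UniformFun.toFun H z)) (f (UniformFun.toFun K z))
    linarith [hC z, hKz z]

theorem completeSpace_weaklyBoundedPredictable [CompleteSpace Φ] :
    CompleteSpace (weaklyBoundedPredictable 𝓕 Φ) :=
  isClosed_weaklyBoundedPredictable.completeSpace_coe

variable (𝓕) in
/-- The values of a bounded predictable process. -/
def boundedPredictable.eval : boundedPredictable 𝓕 →ₗ[ℝ] ℝ≥0 × Ω → ℝ where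
  toFun h z := (h : lp (fun _ : ℝ≥0 × Ω => ℝ) ∞) z
  map_add' _ _ := rfl
  map_smul' _ _ := rfl

theorem isWeakModel_weaklyBoundedPredictable :
    IsWeakModel (boundedPredictable.eval 𝓕) (weaklyBoundedPredictable 𝓕 Φ) where
  norm_le_iff a _ hC := ⟨fun h z => (lp.norm_apply_le_norm ENNReal.top_ne_zero a.1 z).trans h,
    fun h => lp.norm_le_of_forall_le (f := a.1) hC h⟩
  mem_iff H := by
    refine forall_congr' fun f => ⟨fun ⟨hm, C, hC⟩ => ?_, fun ⟨a, ha⟩ => ?_⟩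
    · exact ⟨⟨⟨fun z => f (UniformFun.toFun H z), memℓp_infty ⟨C, by
        rintro _ ⟨z, rfl⟩; exact hC z⟩⟩, hm⟩, fun z => rfl⟩
    · have h := funext ha
      refine ⟨h ▸ a.2, ‖a‖, fun z => ?_⟩
      rw [← ha z]
      exact lp.norm_apply_le_norm ENNReal.top_ne_zero a.1 z

end Predictable

end

theorem mainTheorem3 {Ω : Type*} {m : MeasurableSpace Ω} (P : Measure Ω) [IsProbabilityMeasure P]
    (𝓕 : Filtration ℝ≥0 m) (_h𝓕 : UsualConditions P 𝓕)
    {Φ : Type*} [AddCommGroup Φ] [Module ℝ Φ] [UniformSpace Φ] [IsUniformAddGroup Φ]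
    [ContinuousSMul ℝ Φ] [LocallyConvexSpace ℝ Φ] [T2Space Φ]
    [CompleteSpace Φ] [BarrelledSpace ℝ Φ] (hΦ : IsNuclearSpace Φ) :
    ∃ (e₁ : CompletedProjTensor Φ (boundedPredictable 𝓕) ≃L[ℝ]
          (StrongDual ℝ Φ →L[ℝ] boundedPredictable 𝓕))
      (e₂ : (StrongDual ℝ Φ →L[ℝ] boundedPredictable 𝓕) ≃L[ℝ] weaklyBoundedPredictable 𝓕 Φ),
      (∀ (φ : Φ) (h : boundedPredictable 𝓕) (f : StrongDual ℝ Φ),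
        e₁ ((ProjTensor.tmul φ h : ProjTensor Φ (boundedPredictable 𝓕)) :
          CompletedProjTensor Φ (boundedPredictable 𝓕)) f = f φ • h) ∧
      (∀ (G : StrongDual ℝ Φ →L[ℝ] boundedPredictable 𝓕) (f : StrongDual ℝ Φ) (z : ℝ≥0 × Ω),
        f (UniformFun.toFun (e₂ G : (ℝ≥0 × Ω) →ᵤ Φ) z) =
          (G f : lp (fun _ : ℝ≥0 × Ω => ℝ) ∞) z) := by
  have hc := isWeakModel_weaklyBoundedPredictable (𝓕 := 𝓕) (Φ := Φ)
  have := completeSpace_weaklyBoundedPredictable (𝓕 := 𝓕) (Φ := Φ)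
  exact ⟨hc.tensorEquiv hΦ, (hc.equiv hΦ).symm, hc.tensorEquiv_tmul hΦ, hc.apply_equiv_symm hΦ⟩
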